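/- Let $P$ and $Q$ be binary-input discrete memoryless channels with finite output alphabets $\mathcal Y$, $\mathcal Z$ and transition probabilities $P(y\mid\theta)$, $Q(z\mid x)$, where $\theta,x\in\{0,1\}$. For $s\in(0,1)$ put $$\mu_P(s)=\ln\sum_{y\in\mathcal Y}P(y\mid 0)^{1-s}P(y\mid 1)^{s}\in[-\infty,0],$$ extended to $s\in\{0,1\}$ by continuity, and define $\mu_Q$ likewise. A protocol with $n$ transmissions works as follows. A bit $\Theta$ is uniform on $\{0,1\}$; given $\Theta$, the teacher's observations $Y_1,\dots,Y_n$ are independent with law $P(\cdot\mid\Theta)$. At each time $t$ the teacher transmits a bit $\hat X_t$ that is a function of $Y_1,\dots,Y_t$. The student receives $Z_1,\dots,Z_n$, which given the teacher's observations and $\Theta$ are independent with $Z_t\sim Q(\cdot\mid\hat X_t)$, and outputs an estimate $\hat\Theta_n\in\{0,1\}$ that is a function of $Z_1,\dots,Z_n$. The teaching strategy is block-structured with length $k\ge 1$ if, for every integer $i\ge1$, the bits transmitted at the times $ki+1,\dots,k(i+1)$ (those that are at most $n$) depend only on the symbols that the teacher receives at the times $k(i-1)+1,\dots,ki$. The learning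 rate of a sequence of protocols, one for each $n$, is $$\mathcal R=\limsup_{n\to\infty}\Big\{-\tfrac1n\ln\mathbb P(\hat\Theta_n\ne\Theta)\Big\}\in[0,\infty].$$ Theorem. Suppose that $\mu_P(s)\le\mu_P(1-s)$ and $\mu_Q(s)\le\mu_Q(1-s)$ for all $s\in[0,\tfrac12]$. Then, for every sequence of protocols whose teaching strategy for $n$ transmissions is block-structured with length $k=k(n)\ge1$, where $k(n)=o(n)$, and for every choice of the student's decision rules, the learning rate satisfies $$\mathcal R\le-\min_{s\in[0,1]}\max\big(\mu_P(s),\mu_Q(s)\big).$$ -/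

import Mathlib

open Filter Topology Asymptotics Set
open scoped ENNReal

namespace TeachLearn

/-- A binary-input discrete memoryless channel with finite output alphabet `𝒴`, given by its
one-use transition probabilities `P(y | x)`.  The inputs `0` and `1` are `false` and `true`. -/
abbrev BinaryChannel (𝒴 : Type*) := Bool → PMF 𝒴

open Classical in
/-- `ρ(A, B, s) = ∑ x, A(x)^(1-s) B(x)^s`.  Only the points of the common support contribute:
for `0 < s < 1` the other terms vanish, and at `s = 0` and `s = 1` this is the extension by
continuity (`0 ^ 0 = 1` would give a different value there). -/
noncomputable def rho {Ω : Type*} [Fintype Ω] (A B : PMF Ω) (s : ℝ) : ℝ≥0∞ :=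
  ∑ x, if A x = 0 ∨ B x = 0 then 0 else A x ^ (1 - s) * B x ^ s

/-- `μ_P(s) = ln ρ(P(·|0), P(·|1), s)`, which is `-∞` if `P(·|0)` and `P(·|1)` have disjoint
supports. -/
noncomputable def mu {𝒴 : Type*} [Fintype 𝒴] (P : BinaryChannel 𝒴) (s : ℝ) : EReal :=
  ENNReal.log (rho (P false) (P true) s)

/-- `μ_P(s) ≤ μ_P(1-s)` for all `s ∈ [0, 1/2]`. -/
def SkewCondition {𝒴 : Type*} [Fintype 𝒴] (P : BinaryChannel 𝒴) : Prop :=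
  ∀ s ∈ Icc (0 : ℝ) (1 / 2), mu P s ≤ mu P (1 - s)

/-- A teaching and learning protocol with `n` transmissions.  Time steps are numbered
`0, …, n - 1`.  At time `t` the teacher sends a bit that is a function of the symbols that it
has received up to and including time `t`.  At the end the student estimates the unknown bit
from the `n` symbols received. -/
structure Protocol (𝒴 𝒵 : Type*) (n : ℕ) where
  /-- `teacher y t` is the bit transmitted at time `t` if the teacher observes `y`. -/
  teacher : (Fin n → 𝒴) → Fin n → Bool
  /-- The teacher does not look into the future. -/
  causal : ∀ (t : Fin n) (y y' : Fin n → 𝒴), (∀ j ≤ t, y j = y' j) → teacher y t = teacher y' t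
  /-- The student's estimate. -/
  student : (Fin n → 𝒵) → Bool

/-- The teaching strategy is block structured with length `k`: the bits that are transmitted in
a block other than the first depend only on the symbols that the teacher receives in the
preceding block.  (The blocks are the time intervals `[k * i, k * (i + 1))`; the last one is
truncated if `k` does not divide `n`.) -/
def Protocol.IsBlockStructured {𝒴 𝒵 : Type*} {n : ℕ} (π : Protocol 𝒴 𝒵 n) (k : ℕ) : Prop :=
  ∀ (i : ℕ) (t : Fin n), k * (i + 1) ≤ (t : ℕ) → (t : ℕ) < k * (i + 2) →
    ∀ y y' : Fin n → 𝒴,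
      (∀ j : Fin n, k * i ≤ (j : ℕ) → (j : ℕ) < k * (i + 1) → y j = y' j) →
      π.teacher y t = π.teacher y' t

/-- The joint probability of `Θ = θ`, of the teacher's observations `y` and of the student's
observations `z`: the bit `Θ` is equiprobable, the teacher sees `Θ` through `n` independent uses
of `P`, and the student sees the transmitted bits through `n` independent uses of `Q`. -/
noncomputable def Protocol.jointProb {𝒴 𝒵 : Type*} {n : ℕ} (π : Protocol 𝒴 𝒵 n)
    (P : BinaryChannel 𝒴) (Q : BinaryChannel 𝒵)
    (θ : Bool) (y : Fin n → 𝒴) (z : Fin n → 𝒵) : ℝ≥0∞ :=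
  2⁻¹ * (∏ t, P θ (y t)) * ∏ t, Q (π.teacher y t) (z t)

/-- The probability that the student's estimate differs from `Θ`. -/
noncomputable def Protocol.errorProb {𝒴 𝒵 : Type*} [Fintype 𝒴] [Fintype 𝒵] {n : ℕ}
    (π : Protocol 𝒴 𝒵 n) (P : BinaryChannel 𝒴) (Q : BinaryChannel 𝒵) : ℝ≥0∞ :=
  ∑ θ, ∑ y, ∑ z, if π.student z = θ then 0 else π.jointProb P Q θ y z

/-- The learning rate `limsup (-(1/n) ln ℙ(error))` of a sequence of protocols, one for each
number `n` of transmissions.  It is an extended real, since the error probability may be `0`. -/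
noncomputable def learningRate {𝒴 𝒵 : Type*} [Fintype 𝒴] [Fintype 𝒵]
    (P : BinaryChannel 𝒴) (Q : BinaryChannel 𝒵) (π : ∀ n : ℕ, Protocol 𝒴 𝒵 n) : EReal :=
  limsup (fun n : ℕ => -(ENNReal.log ((π n).errorProb P Q) / (n : EReal))) atTop

end TeachLearn

/-! Let F₀, F₁ be the laws of the student's observations under the two hypotheses, and m the minimum
over s of the larger of μ_P(s), μ_Q(s), taken finite. The error probability is at least half the
overlap ∑ min(F₀, F₁), so it suffices to bound the overlap below by exp(nm - o(n)).

The Chernoff coefficient ∑ F₀^(1-s) F₁^s is at least exp(nm) at every s, by superadditivity of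
a^(1-s) b^s. Keeping the teacher's observations gives ρ_P(s)^n. Writing F₀ and F₁ as mixtures over
one independent pair of observation strings gives min(ρ_Q(s), ρ_Q(1-s))^n, complementary letters
being the worst case. The skewness conditions make one of the two bounds sufficient: for s ≤ 1/2
compare with the maximum at s, for s ≥ 1/2 with that at 1-s (`Protocol.pow_le_output`).

A large Chernoff coefficient at every s does not by itself force a large overlap. The block
structure supplies the converse: F₀ and F₁ are products over blocks whose log-likelihood ratios are
O(k). Tilting to the s where the mean ratio vanishes, Chebyshev's inequality confines the total
ratio to O(√(kn)) with probability at least 1/2, and there F₀ and F₁ both match the tilted weight up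
to exp(O(√(kn))) (`le_sum_min_prod`). Since k = o(n), this loss is negligible. -/

namespace TeachLearn

/-! ### The Chernoff summand -/

/-- The summand `a ^ (1 - s) * b ^ s` of the Chernoff coefficient, set to `0` off the common
support. -/
noncomputable def geomWeight (s a b : ℝ) : ℝ := if a = 0 ∨ b = 0 then 0 else a ^ (1 - s) * b ^ s

lemma geomWeight_nonneg (s : ℝ) {a b : ℝ} (ha : 0 ≤ a) (hb : 0 ≤ b) : 0 ≤ geomWeight s a b := by
  unfold geomWeight
  split_ifs
  · rfl
  · positivity

lemma geomWeight_mul (s : ℝ) {a b c d : ℝ} (ha : 0 ≤ a) (hb : 0 ≤ b) (hc : 0 ≤ c) (hd : 0 ≤ d) :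
    geomWeight s (a * c) (b * d) = geomWeight s a b * geomWeight s c d := by
  unfold geomWeight
  by_cases h1 : a = 0 <;> by_cases h2 : b = 0 <;> by_cases h3 : c = 0 <;> by_cases h4 : d = 0 <;>
    simp only [h1, h2, h3, h4, zero_mul, mul_zero, true_or, or_true, or_self, if_true,
      mul_eq_zero, if_false]
  rw [Real.mul_rpow ha hc, Real.mul_rpow hb hd]
  ring

lemma geomWeight_self (s : ℝ) {a : ℝ} (ha : 0 ≤ a) : geomWeight s a a = a := by
  unfold geomWeight
  split_ifs with h
  · simpa [eq_comm] using h
  · have : 0 < a := lt_of_le_of_ne ha (by tauto)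
    rw [← Real.rpow_add this]
    simp

lemma geomWeight_swap (s a b : ℝ) : geomWeight s a b = geomWeight (1 - s) b a := by
  unfold geomWeight
  simp only [or_comm, sub_sub_cancel, mul_comm]

lemma geomWeight_prod {ι : Type*} (S : Finset ι) (s : ℝ) (a b : ι → ℝ) (ha : ∀ i, 0 ≤ a i)
    (hb : ∀ i, 0 ≤ b i) :
    geomWeight s (∏ i ∈ S, a i) (∏ i ∈ S, b i) = ∏ i ∈ S, geomWeight s (a i) (b i) := by
  classical
  induction S using Finset.induction_on with
  | empty => simp [geomWeight]
  | insert i S hi ih =>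
    rw [Finset.prod_insert hi, Finset.prod_insert hi, Finset.prod_insert hi, ← ih,
      geomWeight_mul s (ha i) (hb i) (Finset.prod_nonneg fun i _ => ha i)
        (Finset.prod_nonneg fun i _ => hb i)]

/-- Superadditivity of the Chernoff summand. -/
lemma sum_geomWeight_le {ι : Type*} (S : Finset ι) {s : ℝ} (hs : s ∈ Icc (0 : ℝ) 1) (a b : ι → ℝ)
    (ha : ∀ i, 0 ≤ a i) (hb : ∀ i, 0 ≤ b i) :
    ∑ i ∈ S, geomWeight s (a i) (b i) ≤ geomWeight s (∑ i ∈ S, a i) (∑ i ∈ S, b i) := by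
  by_cases hA : ∑ i ∈ S, a i = 0
  · have h0 := (Finset.sum_eq_zero_iff_of_nonneg fun i _ => ha i).1 hA
    rw [Finset.sum_eq_zero fun i hi => by simp [geomWeight, h0 i hi]]
    exact geomWeight_nonneg s (Finset.sum_nonneg fun i _ => ha i) (Finset.sum_nonneg fun i _ => hb i)
  by_cases hB : ∑ i ∈ S, b i = 0
  · have h0 := (Finset.sum_eq_zero_iff_of_nonneg fun i _ => hb i).1 hB
    rw [Finset.sum_eq_zero fun i hi => by simp [geomWeight, h0 i hi]]
    exact geomWeight_nonneg s (Finset.sum_nonneg fun i _ => ha i) (Finset.sum_nonneg fun i _ => hb i)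
  set A := ∑ i ∈ S, a i with hAdef
  set B := ∑ i ∈ S, b i with hBdef
  have hA0 : 0 < A := lt_of_le_of_ne (Finset.sum_nonneg fun i _ => ha i) (Ne.symm hA)
  have hB0 : 0 < B := lt_of_le_of_ne (Finset.sum_nonneg fun i _ => hb i) (Ne.symm hB)
  have hG : geomWeight s A B = A ^ (1 - s) * B ^ s := by simp [geomWeight, hA, hB]
  -- Weighted AM-GM after normalising by the totals; summed over `i`, the bracket becomes (1 - s) +
  -- s = 1.
  have hterm : ∀ i ∈ S, geomWeight s (a i) (b i)
      ≤ A ^ (1 - s) * B ^ s * ((1 - s) * (a i / A) + s * (b i / B)) := by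
    intro i _
    have hamgm := Real.geom_mean_le_arith_mean2_weighted (sub_nonneg.2 hs.2) hs.1
      (div_nonneg (ha i) hA0.le) (div_nonneg (hb i) hB0.le) (by ring)
    have hle : geomWeight s (a i) (b i) ≤ a i ^ (1 - s) * b i ^ s := by
      unfold geomWeight
      split_ifs
      · exact mul_nonneg (Real.rpow_nonneg (ha i) _) (Real.rpow_nonneg (hb i) _)
      · rfl
    refine hle.trans ?_
    rw [Real.div_rpow (ha i) hA0.le, Real.div_rpow (hb i) hB0.le] at hamgm
    have hA1 : 0 < A ^ (1 - s) := Real.rpow_pos_of_pos hA0 _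
    have hB1 : 0 < B ^ s := Real.rpow_pos_of_pos hB0 _
    calc a i ^ (1 - s) * b i ^ s
        = A ^ (1 - s) * B ^ s * (a i ^ (1 - s) / A ^ (1 - s) * (b i ^ s / B ^ s)) := by
          field_simp
      _ ≤ _ := mul_le_mul_of_nonneg_left hamgm (by positivity)
  refine (Finset.sum_le_sum hterm).trans (le_of_eq ?_)
  rw [hG, ← Finset.mul_sum, Finset.sum_add_distrib, ← Finset.mul_sum, ← Finset.mul_sum,
    ← Finset.sum_div, ← Finset.sum_div, ← hAdef, ← hBdef, div_self hA, div_self hB]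
  ring

/-- The value 0 off the common support avoids the jumps that `0 ^ 0 = 1` would cause at s = 0 and s
= 1, so the intermediate value theorem applies on the closed interval. -/
lemma continuous_geomWeight (a b : ℝ) : Continuous fun s => geomWeight s a b := by
  unfold geomWeight
  split_ifs with h
  · exact continuous_const
  · rw [not_or] at h
    exact ((Real.continuous_const_rpow h.1).comp (continuous_const.sub continuous_id)).mul
      (Real.continuous_const_rpow h.2)

/-! ### Overlap of product distributions -/

section Product

variable {ι : Type*} [Fintype ι] [DecidableEq ι] {α : ι → Type*} [∀ i, Fintype (α i)]

lemma sum_pi_prod (g : ∀ i, α i → ℝ) : ∑ z : ∀ i, α i, ∏ i, g i (z i) = ∏ i, ∑ x, g i x := by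
  rw [Finset.prod_univ_sum, Fintype.piFinset_univ]

/-- The expectation of a product of two centred functions of the coordinates, under a product
distribution. -/
lemma sum_pi_prod_mul_mul (τ a : ∀ i, α i → ℝ) (hτ : ∀ i, ∑ x, τ i x = 1)
    (ha : ∀ i, ∑ x, τ i x * a i x = 0) (i j : ι) :
    ∑ z : ∀ i, α i, (∏ l, τ l (z l)) * (a i (z i) * a j (z j))
      = if i = j then ∑ x, τ i x * a i x ^ 2 else 0 := by
  -- Indicator exponents turn the integrand into a product over all coordinates, so that the sum
  -- factors.
  have key : ∀ z : ∀ i, α i, (∏ l, τ l (z l)) * (a i (z i) * a j (z j))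
      = ∏ l, τ l (z l) * ((if l = i then a l (z l) else 1) * (if l = j then a l (z l) else 1)) := by
    intro z
    rw [Finset.prod_mul_distrib, Finset.prod_mul_distrib]
    simp
  rw [Finset.sum_congr rfl fun z _ => key z, sum_pi_prod
    (fun l x => τ l x * ((if l = i then a l x else 1) * (if l = j then a l x else 1)))]
  split_ifs with hij
  · subst hij
    rw [Finset.prod_eq_single i]
    · simp [sq]
    · intro l _ hl
      simp [hl, hτ]
    · simp
  · refine Finset.prod_eq_zero (Finset.mem_univ i) ?_
    simp [hij, ha]

/-- Independence kills the cross terms, and each variance is at most a second moment. -/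
lemma variance_sum_le (τ f : ∀ i, α i → ℝ) (c : ι → ℝ) (h0 : ∀ i x, 0 ≤ τ i x)
    (hτ : ∀ i, ∑ x, τ i x = 1) (hf : ∀ i x, |f i x| ≤ c i) :
    ∑ z : ∀ i, α i, (∏ i, τ i (z i)) * (∑ i, f i (z i) - ∑ i, ∑ x, τ i x * f i x) ^ 2
      ≤ ∑ i, c i ^ 2 := by
  set m : ι → ℝ := fun i => ∑ x, τ i x * f i x with hm
  set a : ∀ i, α i → ℝ := fun i x => f i x - m i with ha
  have ha0 : ∀ i, ∑ x, τ i x * a i x = 0 := by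
    intro i
    simp only [ha, mul_sub, Finset.sum_sub_distrib, ← Finset.sum_mul, hτ]
    simp [hm]
  have hexp : ∀ z : ∀ i, α i, (∏ i, τ i (z i)) * (∑ i, f i (z i) - ∑ i, m i) ^ 2
      = ∑ i, ∑ j, (∏ l, τ l (z l)) * (a i (z i) * a j (z j)) := by
    intro z
    rw [← Finset.sum_sub_distrib, sq, Finset.sum_mul_sum, Finset.mul_sum]
    simp only [Finset.mul_sum, ha]
  rw [Finset.sum_congr rfl fun z _ => hexp z, Finset.sum_comm]
  refine Finset.sum_le_sum fun i _ => ?_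
  rw [Finset.sum_comm]
  simp only [sum_pi_prod_mul_mul τ a hτ ha0, Finset.sum_ite_eq, Finset.mem_univ, if_true]
  have hvar : ∑ x, τ i x * a i x ^ 2 = ∑ x, τ i x * f i x ^ 2 - m i ^ 2 := by
    have : ∀ x, τ i x * a i x ^ 2
        = τ i x * f i x ^ 2 - 2 * m i * (τ i x * f i x) + m i ^ 2 * τ i x := by
      intro x
      simp only [ha]
      ring
    rw [Finset.sum_congr rfl fun x _ => this x, Finset.sum_add_distrib, Finset.sum_sub_distrib,
      ← Finset.mul_sum, ← Finset.mul_sum, hτ]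
    simp only [hm]
    ring
  have hle : ∑ x, τ i x * f i x ^ 2 ≤ ∑ x, τ i x * c i ^ 2 :=
    Finset.sum_le_sum fun x _ => mul_le_mul_of_nonneg_left (sq_le_sq' (abs_le.1 (hf i x)).1
      (abs_le.1 (hf i x)).2) (h0 i x)
  rw [← Finset.sum_mul, hτ] at hle
  nlinarith [sq_nonneg (m i)]

/-- Chebyshev's inequality on a finite type. -/
lemma half_le_sum_filter {β : Type*} [Fintype β] (T X : β → ℝ) (M d V : ℝ) (hT : ∀ z, 0 ≤ T z)
    (h1 : ∑ z, T z = 1) (hd : 0 < d) (hV : ∑ z, T z * (X z - M) ^ 2 ≤ V) (hdV : 2 * V ≤ d ^ 2) :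
    1 / 2 ≤ ∑ z with |X z - M| ≤ d, T z := by
  have hsplit := Finset.sum_filter_add_sum_filter_not Finset.univ (fun z => |X z - M| ≤ d) T
  have hbad : d ^ 2 * ∑ z with ¬ |X z - M| ≤ d, T z ≤ V := by
    refine le_trans ?_ hV
    rw [Finset.mul_sum]
    refine le_trans (Finset.sum_le_sum (g := fun z => T z * (X z - M) ^ 2) fun z hz => ?_)
      (Finset.sum_le_sum_of_subset_of_nonneg (Finset.filter_subset _ _)
        fun z _ _ => mul_nonneg (hT z) (sq_nonneg _))
    have hz' := (not_le.1 (Finset.mem_filter.1 hz).2).le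
    rw [mul_comm, ← sq_abs (X z - M)]
    exact mul_le_mul_of_nonneg_left (pow_le_pow_left₀ hd.le hz' 2) (hT z)
  have : d ^ 2 * ∑ z with ¬ |X z - M| ≤ d, T z ≤ d ^ 2 * (1 / 2) := by linarith
  have := le_of_mul_le_mul_left this (by positivity)
  linarith

/-- A lower bound on the overlap of two product distributions in terms of their Chernoff
coefficients, when the log-likelihood ratios of the factors are bounded on the common supports. -/
theorem le_sum_min_prod (u v : ∀ i, α i → ℝ) (c : ι → ℝ) (hu : ∀ i x, 0 ≤ u i x)
    (hv : ∀ i x, 0 ≤ v i x) (hc : ∀ i x, |Real.log (v i x / u i x)| ≤ c i) {R d : ℝ} (hR : 0 < R)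
    (hρ : ∀ s ∈ Icc (0 : ℝ) 1,
      R ≤ ∑ z : ∀ i, α i, geomWeight s (∏ i, u i (z i)) (∏ i, v i (z i)))
    (hd : 0 < d) (hdc : 2 * ∑ i, c i ^ 2 ≤ d ^ 2) :
    R / 2 * Real.exp (-d) ≤ ∑ z : ∀ i, α i, min (∏ i, u i (z i)) (∏ i, v i (z i)) := by
  set ρ : ℝ → ι → ℝ := fun s i => ∑ x, geomWeight s (u i x) (v i x) with hρdef
  have hfac : ∀ s, ∑ z : ∀ i, α i, geomWeight s (∏ i, u i (z i)) (∏ i, v i (z i)) = ∏ i, ρ s i := by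
    intro s
    rw [← sum_pi_prod fun i x => geomWeight s (u i x) (v i x)]
    exact Finset.sum_congr rfl fun z _ => geomWeight_prod _ _ _ _ (fun i => hu i _) fun i => hv i _
  have hρ0 : ∀ s i, 0 ≤ ρ s i :=
    fun s i => Finset.sum_nonneg fun x _ => geomWeight_nonneg _ (hu i x) (hv i x)
  have hρpos : ∀ s ∈ Icc (0 : ℝ) 1, ∀ i, 0 < ρ s i := by
    intro s hs i
    refine lt_of_le_of_ne (hρ0 s i) fun h => ?_
    have := hρ s hs
    rw [hfac, Finset.prod_eq_zero (Finset.mem_univ i) h.symm] at this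
    linarith
  set ℓ : ∀ i, α i → ℝ := fun i x => Real.log (v i x / u i x) with hℓ
  set τ : ℝ → ∀ i, α i → ℝ := fun s i x => geomWeight s (u i x) (v i x) / ρ s i with hτ
  set M : ℝ → ℝ := fun s => ∑ i, ∑ x, τ s i x * ℓ i x with hM
  have hcont : ContinuousOn M (Icc 0 1) := by
    refine continuousOn_finsetSum _ fun i _ => continuousOn_finsetSum _ fun x _ => ?_
    refine ContinuousOn.mul (ContinuousOn.div (continuous_geomWeight _ _).continuousOn ?_
      fun s hs => (hρpos s hs i).ne') continuousOn_const
    exact (continuous_finsetSum _ fun x _ => continuous_geomWeight _ _).continuousOn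
  -- `M` is the derivative of the convex function log ∏ `ρ s i`, so this `s` is its minimiser on [0,
  -- 1], with the sign of the derivative recorded at an endpoint.
  obtain ⟨s, hs, hcase⟩ : ∃ s ∈ Icc (0 : ℝ) 1, M s = 0 ∨ (s = 0 ∧ 0 ≤ M s) ∨ (s = 1 ∧ M s ≤ 0) := by
    rcases le_total 0 (M 0) with h0 | h0
    · exact ⟨0, by simp, Or.inr (Or.inl ⟨rfl, h0⟩)⟩
    rcases le_total (M 1) 0 with h1 | h1
    · exact ⟨1, by simp, Or.inr (Or.inr ⟨rfl, h1⟩)⟩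
    obtain ⟨s, hs, h⟩ := intermediate_value_Icc zero_le_one hcont ⟨h0, h1⟩
    exact ⟨s, hs, Or.inl h⟩
  have hτ0 : ∀ i x, 0 ≤ τ s i x := fun i x =>
    div_nonneg (geomWeight_nonneg _ (hu i x) (hv i x)) (hρ0 s i)
  have hτ1 : ∀ i, ∑ x, τ s i x = 1 := fun i => by
    simp only [hτ, ← Finset.sum_div]
    exact div_self (hρpos s hs i).ne'
  have hvar := variance_sum_le (τ s) ℓ c hτ0 hτ1 hc
  have hmass := half_le_sum_filter (fun z : ∀ i, α i => ∏ i, τ s i (z i)) (fun z => ∑ i, ℓ i (z i))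
    (M s) d _ (fun z => Finset.prod_nonneg fun i _ => hτ0 i _)
    (by rw [sum_pi_prod]; simp [hτ1]) hd hvar hdc
  have hpt : ∀ z : ∀ i, α i, |∑ i, ℓ i (z i) - M s| ≤ d →
      (R * Real.exp (-d)) * ∏ i, τ s i (z i) ≤ min (∏ i, u i (z i)) (∏ i, v i (z i)) := by
    intro z hz
    have hT : (∏ i, ρ s i) * ∏ i, τ s i (z i)
        = geomWeight s (∏ i, u i (z i)) (∏ i, v i (z i)) := by
      rw [geomWeight_prod _ _ _ _ (fun i => hu i _) fun i => hv i _, ← Finset.prod_mul_distrib]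
      exact Finset.prod_congr rfl fun i _ => mul_div_cancel₀ _ (hρpos s hs i).ne'
    have hRT : R * ∏ i, τ s i (z i) ≤ geomWeight s (∏ i, u i (z i)) (∏ i, v i (z i)) := by
      rw [← hT]
      exact mul_le_mul_of_nonneg_right ((hρ s hs).trans_eq (hfac s))
        (Finset.prod_nonneg fun i _ => hτ0 i _)
    suffices h : geomWeight s (∏ i, u i (z i)) (∏ i, v i (z i)) * Real.exp (-d)
        ≤ min (∏ i, u i (z i)) (∏ i, v i (z i)) by
      calc _ = (R * ∏ i, τ s i (z i)) * Real.exp (-d) := by ring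
        _ ≤ _ := mul_le_mul_of_nonneg_right hRT (Real.exp_pos _).le
        _ ≤ _ := h
    have hU0 : 0 ≤ ∏ i, u i (z i) := Finset.prod_nonneg fun i _ => hu i _
    have hV0 : 0 ≤ ∏ i, v i (z i) := Finset.prod_nonneg fun i _ => hv i _
    by_cases hsupp : (∏ i, u i (z i)) = 0 ∨ (∏ i, v i (z i)) = 0
    · simp only [geomWeight, if_pos hsupp, zero_mul]
      exact le_min hU0 hV0
    rw [not_or] at hsupp
    have hL : ∑ i, ℓ i (z i) = Real.log (∏ i, v i (z i)) - Real.log (∏ i, u i (z i)) := by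
      have hu' := fun i => (Finset.prod_ne_zero_iff.1 hsupp.1) i (Finset.mem_univ i)
      have hv' := fun i => (Finset.prod_ne_zero_iff.1 hsupp.2) i (Finset.mem_univ i)
      rw [Real.log_prod fun i _ => hv' i, Real.log_prod fun i _ => hu' i,
        ← Finset.sum_sub_distrib]
      exact Finset.sum_congr rfl fun i _ => Real.log_div (hv' i) (hu' i)
    rw [hL] at hz
    set U := ∏ i, u i (z i)
    set V := ∏ i, v i (z i)
    have hU : 0 < U := lt_of_le_of_ne hU0 (Ne.symm hsupp.1)
    have hV : 0 < V := lt_of_le_of_ne hV0 (Ne.symm hsupp.2)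
    have hG : geomWeight s U V * Real.exp (-d)
        = Real.exp ((1 - s) * Real.log U + s * Real.log V - d) := by
      simp only [geomWeight, hsupp.1, hsupp.2, or_self, if_false]
      rw [Real.rpow_def_of_pos hU, Real.rpow_def_of_pos hV, ← Real.exp_add, ← Real.exp_add]
      congr 1
      ring
    rw [hG]
    obtain ⟨hz1, hz2⟩ := abs_le.1 hz
    obtain ⟨hs0, hs1⟩ := hs
    -- With L = log V - log U, the weight is U exp(sL) = V exp(-(1-s)L). If `M s = 0`, then |L| ≤ d
    -- bounds both exponents by d; at an endpoint one exponent is 0 and the sign of `M s` controls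
    -- the other.
    refine le_min ?_ ?_
    · rw [← Real.le_log_iff_exp_le hU]
      rcases hcase with h | ⟨h, h'⟩ | ⟨h, h'⟩
      · nlinarith
      · subst h; linarith
      · subst h; linarith
    · rw [← Real.le_log_iff_exp_le hV]
      rcases hcase with h | ⟨h, h'⟩ | ⟨h, h'⟩
      · nlinarith
      · subst h; linarith
      · subst h; linarith
  calc R / 2 * Real.exp (-d) = (R * Real.exp (-d)) * (1 / 2) := by ring
    _ ≤ (R * Real.exp (-d)) * ∑ z : ∀ i, α i with |∑ i, ℓ i (z i) - M s| ≤ d, ∏ i, τ s i (z i) :=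
        mul_le_mul_of_nonneg_left hmass (by positivity)
    _ ≤ ∑ z : ∀ i, α i with |∑ i, ℓ i (z i) - M s| ≤ d,
          min (∏ i, u i (z i)) (∏ i, v i (z i)) := by
        rw [Finset.mul_sum]
        exact Finset.sum_le_sum fun z hz => hpt z (Finset.mem_filter.1 hz).2
    _ ≤ _ := Finset.sum_le_sum_of_subset_of_nonneg (Finset.filter_subset _ _) fun z _ _ =>
        le_min (Finset.prod_nonneg fun i _ => hu i _) (Finset.prod_nonneg fun i _ => hv i _)

end Product

/-! ### Chernoff coefficient of the student's observations -/

section Output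

variable {𝒴 𝒵 : Type*} [Fintype 𝒴]

/-- The real-valued output distribution: the probability that the student receives `z` given
`Θ = θ`, when the one-use transition probabilities are `p` and `q`. -/
noncomputable def Protocol.output {n : ℕ} (π : Protocol 𝒴 𝒵 n) (p : Bool → 𝒴 → ℝ)
    (q : Bool → 𝒵 → ℝ) (θ : Bool) (z : Fin n → 𝒵) : ℝ :=
  ∑ y : Fin n → 𝒴, (∏ t, p θ (y t)) * ∏ t, q (π.teacher y t) (z t)

lemma sum_fun_prod {κ β : Type*} [Fintype κ] [DecidableEq κ] [Fintype β] (g : κ → β → ℝ) :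
    ∑ z : κ → β, ∏ t, g t (z t) = ∏ t, ∑ x, g t x :=
  sum_pi_prod g

section Coefficient

variable [Fintype 𝒵] {n : ℕ} (π : Protocol 𝒴 𝒵 n) {p : Bool → 𝒴 → ℝ} {q : Bool → 𝒵 → ℝ}

/-- Data processing through the student's channel and the teaching strategy. -/
lemma Protocol.pow_le_output_of_teacher (hp : ∀ θ x, 0 ≤ p θ x) (hq : ∀ θ x, 0 ≤ q θ x)
    (hq1 : ∀ θ, ∑ x, q θ x = 1) {s : ℝ} (hs : s ∈ Icc (0 : ℝ) 1) :
    (∑ x, geomWeight s (p false x) (p true x)) ^ n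
      ≤ ∑ z, geomWeight s (π.output p q false z) (π.output p q true z) := by
  have hstep : ∀ z : Fin n → 𝒵,
      ∑ y : Fin n → 𝒴, (∏ t, geomWeight s (p false (y t)) (p true (y t)))
          * ∏ t, q (π.teacher y t) (z t)
        ≤ geomWeight s (π.output p q false z) (π.output p q true z) := by
    intro z
    refine le_trans (le_of_eq (Finset.sum_congr rfl fun y _ => ?_)) (sum_geomWeight_le _ hs _ _
      (fun y => mul_nonneg (Finset.prod_nonneg fun t _ => hp _ _)
        (Finset.prod_nonneg fun t _ => hq _ _))
      (fun y => mul_nonneg (Finset.prod_nonneg fun t _ => hp _ _)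
        (Finset.prod_nonneg fun t _ => hq _ _)))
    rw [geomWeight_mul s (Finset.prod_nonneg fun t _ => hp _ _)
      (Finset.prod_nonneg fun t _ => hp _ _) (Finset.prod_nonneg fun t _ => hq _ _)
      (Finset.prod_nonneg fun t _ => hq _ _), geomWeight_self s (Finset.prod_nonneg fun t _ => hq _ _),
      geomWeight_prod _ _ _ _ (fun t => hp _ _) fun t => hp _ _]
  refine le_trans (le_of_eq ?_) (Finset.sum_le_sum fun z _ => hstep z)
  rw [Finset.sum_comm]
  simp only [← Finset.mul_sum]
  have hone : ∀ y : Fin n → 𝒴, ∑ z : Fin n → 𝒵, ∏ t, q (π.teacher y t) (z t) = 1 := fun y => by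
    rw [sum_fun_prod fun t x => q (π.teacher y t) x]
    simp [hq1]
  simp only [hone, mul_one]
  rw [sum_fun_prod fun (_ : Fin n) x => geomWeight s (p false x) (p true x)]
  simp

/-- Whatever the teacher sends, the student does not distinguish the hypotheses better than from
`n` uses of the channel with complementary inputs. -/
lemma Protocol.pow_le_output_of_student (hp : ∀ θ x, 0 ≤ p θ x) (hq : ∀ θ x, 0 ≤ q θ x)
    (hp1 : ∀ θ, ∑ x, p θ x = 1) (hq1 : ∀ θ, ∑ x, q θ x = 1) {s r : ℝ} (hs : s ∈ Icc (0 : ℝ) 1)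
    (hr : 0 ≤ r) (h1 : r ≤ ∑ x, geomWeight s (q false x) (q true x))
    (h2 : r ≤ ∑ x, geomWeight s (q true x) (q false x)) :
    r ^ n ≤ ∑ z, geomWeight s (π.output p q false z) (π.output p q true z) := by
  have hsum : ∀ θ, ∑ y : Fin n → 𝒴, ∏ t, p θ (y t) = 1 := fun θ => by
    rw [sum_fun_prod fun (_ : Fin n) x => p θ x]
    simp [hp1]
  have hpn : ∀ θ (y : Fin n → 𝒴), 0 ≤ ∏ t, p θ (y t) := fun θ y =>
    Finset.prod_nonneg fun t _ => hp _ _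
  have hqn : ∀ (y : Fin n → 𝒴) (z : Fin n → 𝒵), 0 ≤ ∏ t, q (π.teacher y t) (z t) := fun y z =>
    Finset.prod_nonneg fun t _ => hq _ _
  -- Covers the times at which both strings make the teacher send the same letter, where the
  -- coefficient is 1.
  have hr1 : r ≤ 1 := by
    refine h1.trans ((sum_geomWeight_le _ hs _ _ (hq _) (hq _)).trans ?_)
    rw [hq1, hq1, geomWeight_self s zero_le_one]
  have hletter : ∀ a b : Bool, r ≤ ∑ x, geomWeight s (q a x) (q b x) := by
    intro a b
    have hself : ∀ a, ∑ x, geomWeight s (q a x) (q a x) = 1 := fun a => by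
      rw [← hq1 a]
      exact Finset.sum_congr rfl fun x _ => geomWeight_self s (hq a x)
    cases a <;> cases b
    · rwa [hself]
    · exact h1
    · exact h2
    · rwa [hself]
  -- Independent coupling of the observations under the two hypotheses: both output laws become
  -- mixtures with the same weights.
  set c : (Fin n → 𝒴) × (Fin n → 𝒴) → ℝ := fun w => (∏ t, p false (w.1 t)) * ∏ t, p true (w.2 t)
    with hc
  have hc0 : ∀ w, 0 ≤ c w := fun w => mul_nonneg (hpn _ _) (hpn _ _)
  have hc1 : ∑ w, c w = 1 := by
    rw [Fintype.sum_prod_type]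
    simp only [hc, ← Finset.mul_sum, hsum, mul_one]
  have hF : ∀ z, π.output p q false z = ∑ w, c w * ∏ t, q (π.teacher w.1 t) (z t) := by
    intro z
    rw [Fintype.sum_prod_type]
    refine Finset.sum_congr rfl fun y _ => ?_
    simp only [hc, ← Finset.sum_mul, ← Finset.mul_sum, hsum, mul_one]
  have hT : ∀ z, π.output p q true z = ∑ w, c w * ∏ t, q (π.teacher w.2 t) (z t) := by
    intro z
    rw [Fintype.sum_prod_type_right]
    refine Finset.sum_congr rfl fun y _ => ?_
    simp only [hc, ← Finset.sum_mul, hsum, one_mul]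
  have hstep : ∀ z : Fin n → 𝒵,
      ∑ w, c w * ∏ t, geomWeight s (q (π.teacher w.1 t) (z t)) (q (π.teacher w.2 t) (z t))
        ≤ geomWeight s (π.output p q false z) (π.output p q true z) := by
    intro z
    rw [hF, hT]
    refine le_trans (le_of_eq (Finset.sum_congr rfl fun w _ => ?_)) (sum_geomWeight_le _ hs _ _
      (fun w => mul_nonneg (hc0 w) (hqn _ _)) (fun w => mul_nonneg (hc0 w) (hqn _ _)))
    rw [geomWeight_mul s (hc0 w) (hc0 w) (hqn _ _) (hqn _ _), geomWeight_self s (hc0 w),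
      geomWeight_prod _ _ _ _ (fun t => hq _ _) fun t => hq _ _]
  refine le_trans ?_ (Finset.sum_le_sum fun z _ => hstep z)
  rw [Finset.sum_comm]
  simp only [← Finset.mul_sum]
  calc r ^ n = ∑ w, c w * r ^ n := by rw [← Finset.sum_mul, hc1, one_mul]
    _ ≤ _ := Finset.sum_le_sum fun w _ => mul_le_mul_of_nonneg_left ?_ (hc0 w)
  rw [sum_fun_prod fun t x => geomWeight s (q (π.teacher w.1 t) x) (q (π.teacher w.2 t) x)]
  calc r ^ n = ∏ _t : Fin n, r := by simp
    _ ≤ _ := Finset.prod_le_prod (fun t _ => hr) fun t _ => hletter _ _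

/-- Under the skewness conditions the Chernoff coefficient of the student's observations is at
least `r ^ n` at every parameter. -/
lemma Protocol.pow_le_output (hp : ∀ θ x, 0 ≤ p θ x) (hq : ∀ θ x, 0 ≤ q θ x)
    (hp1 : ∀ θ, ∑ x, p θ x = 1) (hq1 : ∀ θ, ∑ x, q θ x = 1)
    (hPskew : ∀ s ∈ Icc (0 : ℝ) (1 / 2), ∑ x, geomWeight s (p false x) (p true x)
      ≤ ∑ x, geomWeight (1 - s) (p false x) (p true x))
    (hQskew : ∀ s ∈ Icc (0 : ℝ) (1 / 2), ∑ x, geomWeight s (q false x) (q true x)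
      ≤ ∑ x, geomWeight (1 - s) (q false x) (q true x))
    {r : ℝ} (hr0 : 0 ≤ r)
    (hr : ∀ s ∈ Icc (0 : ℝ) 1, r ≤ max (∑ x, geomWeight s (p false x) (p true x))
      (∑ x, geomWeight s (q false x) (q true x)))
    {s : ℝ} (hs : s ∈ Icc (0 : ℝ) 1) :
    r ^ n ≤ ∑ z, geomWeight s (π.output p q false z) (π.output p q true z) := by
  have hswap : ∀ s, ∑ x, geomWeight s (q true x) (q false x)
      = ∑ x, geomWeight (1 - s) (q false x) (q true x) := fun s =>
    Finset.sum_congr rfl fun x _ => geomWeight_swap _ _ _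
  rcases le_total s (1 / 2) with h | h
  · rcases le_max_iff.1 (hr s hs) with h' | h'
    · exact (pow_le_pow_left₀ hr0 h' n).trans (π.pow_le_output_of_teacher hp hq hq1 hs)
    · refine π.pow_le_output_of_student hp hq hp1 hq1 hs hr0 h' ?_
      rw [hswap]
      exact h'.trans (hQskew s ⟨hs.1, h⟩)
  -- The coefficient at `s` is compared with the maximum at 1 - s, which skewness shows to be the
  -- smaller side for both channels.
  · have hs' : 1 - s ∈ Icc (0 : ℝ) (1 / 2) := ⟨by linarith [hs.2], by linarith⟩
    have hP := hPskew _ hs'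
    have hQ := hQskew _ hs'
    rw [sub_sub_cancel] at hP hQ
    rcases le_max_iff.1 (hr (1 - s) ⟨hs'.1, by linarith [hs.1]⟩) with h' | h'
    · exact (pow_le_pow_left₀ hr0 (h'.trans hP) n).trans (π.pow_le_output_of_teacher hp hq hq1 hs)
    · refine π.pow_le_output_of_student hp hq hp1 hq1 hs hr0 (h'.trans hQ) ?_
      rwa [hswap]

end Coefficient

/-! ### Factorisation over blocks -/

section Blocks

/-- A function is the same thing as the family of its restrictions to the fibres of `b`. -/
def fiberPiEquiv {κ ι : Type*} (b : κ → ι) (β : Type*) :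
    (κ → β) ≃ ∀ i, ({j // b j = i} → β) where
  toFun y _ j := y j
  invFun η j := η (b j) ⟨j, rfl⟩
  left_inv _ := rfl
  right_inv η := by
    funext i ⟨j, hj⟩
    subst hj
    rfl

variable {n : ℕ} {ι : Type*} [DecidableEq ι]

/-- Extends a string of symbols in one block by a constant. -/
def blockExtend {κ β : Type*} (b : κ → ι) (x₀ : β) (i : ι) (η : {j // b j = i} → β) (j : κ) : β :=
  if h : b j = i then η ⟨j, h⟩ else x₀

/-- The distribution of the symbols that the student receives in the block `i`. -/
noncomputable def Protocol.blockOutput (π : Protocol 𝒴 𝒵 n) (bY bZ : Fin n → ι) (y₀ : 𝒴)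
    (p : Bool → 𝒴 → ℝ) (q : Bool → 𝒵 → ℝ) (θ : Bool) (i : ι) (ζ : {t // bZ t = i} → 𝒵) : ℝ :=
  ∑ η : {j // bY j = i} → 𝒴, (∏ j, p θ (η j))
    * ∏ t : {t // bZ t = i}, q (π.teacher (blockExtend bY y₀ i η) t) (ζ t)

/-- Bits sent on a fibre of `bZ` see only the matching fibre of `bY`, so the sum over `y` splits by
distributivity. The padding symbol `y₀` is immaterial by `hdep`. -/
lemma Protocol.output_eq_prod [Fintype ι] (π : Protocol 𝒴 𝒵 n) (bY bZ : Fin n → ι) (y₀ : 𝒴)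
    (hdep : ∀ (t : Fin n) (y y' : Fin n → 𝒴), (∀ j, bY j = bZ t → y j = y' j) →
      π.teacher y t = π.teacher y' t)
    (p : Bool → 𝒴 → ℝ) (q : Bool → 𝒵 → ℝ) (θ : Bool) (z : Fin n → 𝒵) :
    π.output p q θ z = ∏ i, π.blockOutput bY bZ y₀ p q θ i (fiberPiEquiv bZ 𝒵 z i) := by
  unfold Protocol.blockOutput
  rw [← sum_pi_prod fun i (η : {j // bY j = i} → 𝒴) => (∏ j, p θ (η j))
    * ∏ t : {t // bZ t = i}, q (π.teacher (blockExtend bY y₀ i η) t) (fiberPiEquiv bZ 𝒵 z i t)]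
  refine Fintype.sum_equiv (fiberPiEquiv bY 𝒴) _ _ fun y => ?_
  rw [Finset.prod_mul_distrib]
  congr 1
  · exact (Fintype.prod_fiberwise bY fun j => p θ (y j)).symm
  · rw [← Fintype.prod_fiberwise bZ fun t => q (π.teacher y t) (z t)]
    refine Finset.prod_congr rfl fun i _ => Finset.prod_congr rfl fun t _ => ?_
    rw [hdep t y (blockExtend bY y₀ i (fiberPiEquiv bY 𝒴 y i))]
    · rfl
    · intro j hj
      simp [blockExtend, fiberPiEquiv, hj.trans t.2]

lemma exp_neg_mul_card_le_prod {κ : Type*} [Fintype κ] {C : ℝ} (f : κ → ℝ)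
    (hf : ∀ j, Real.exp (-C) ≤ f j) : Real.exp (-(C * Fintype.card κ)) ≤ ∏ j, f j := by
  calc Real.exp (-(C * Fintype.card κ)) = ∏ _j : κ, Real.exp (-C) := by
        rw [Finset.prod_const, Finset.card_univ, ← Real.exp_nat_mul]
        congr 1
        ring
    _ ≤ _ := Finset.prod_le_prod (fun _ _ => (Real.exp_pos _).le) fun j _ => hf j

variable (π : Protocol 𝒴 𝒵 n) (bY bZ : Fin n → ι) (y₀ : 𝒴) {p : Bool → 𝒴 → ℝ} {q : Bool → 𝒵 → ℝ}

lemma Protocol.blockOutput_nonneg (hp : ∀ θ x, 0 ≤ p θ x) (hq : ∀ θ x, 0 ≤ q θ x) (θ : Bool)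
    (i : ι) (ζ : {t // bZ t = i} → 𝒵) : 0 ≤ π.blockOutput bY bZ y₀ p q θ i ζ :=
  Finset.sum_nonneg fun _ _ => mul_nonneg (Finset.prod_nonneg fun _ _ => hp _ _)
    (Finset.prod_nonneg fun _ _ => hq _ _)

lemma Protocol.blockOutput_le_one [Fintype 𝒵] (hp : ∀ θ x, 0 ≤ p θ x) (hq : ∀ θ x, 0 ≤ q θ x)
    (hp1 : ∀ θ, ∑ x, p θ x = 1) (hq1 : ∀ θ, ∑ x, q θ x = 1) (θ : Bool)
    (i : ι) (ζ : {t // bZ t = i} → 𝒵) : π.blockOutput bY bZ y₀ p q θ i ζ ≤ 1 := by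
  have hle : ∀ a x, q a x ≤ 1 := fun a x =>
    (hq1 a) ▸ Finset.single_le_sum (fun x _ => hq a x) (Finset.mem_univ x)
  calc π.blockOutput bY bZ y₀ p q θ i ζ ≤ ∑ η : {j // bY j = i} → 𝒴, ∏ j, p θ (η j) :=
        Finset.sum_le_sum fun η _ => mul_le_of_le_one_right (Finset.prod_nonneg fun _ _ => hp _ _)
          (Finset.prod_le_one (fun _ _ => hq _ _) fun _ _ => hle _ _)
    _ = 1 := by
        rw [sum_fun_prod fun (_ : {j // bY j = i}) x => p θ x]
        simp [hp1]

lemma Protocol.exp_le_blockOutput (hp : ∀ θ x, 0 ≤ p θ x) (hq : ∀ θ x, 0 ≤ q θ x) {C : ℝ}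
    (hpC : ∀ θ x, p θ x ≠ 0 → Real.exp (-C) ≤ p θ x)
    (hqC : ∀ θ x, q θ x ≠ 0 → Real.exp (-C) ≤ q θ x) (θ : Bool)
    (i : ι) (ζ : {t // bZ t = i} → 𝒵) (h0 : π.blockOutput bY bZ y₀ p q θ i ζ ≠ 0) :
    Real.exp (-(C * (Fintype.card {j // bY j = i} + Fintype.card {t // bZ t = i})))
      ≤ π.blockOutput bY bZ y₀ p q θ i ζ := by
  obtain ⟨η, -, hη⟩ := Finset.exists_ne_zero_of_sum_ne_zero h0
  have h1 := Finset.prod_ne_zero_iff.1 (left_ne_zero_of_mul hη)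
  have h2 := Finset.prod_ne_zero_iff.1 (right_ne_zero_of_mul hη)
  refine le_trans ?_ (Finset.single_le_sum (fun η _ => mul_nonneg
    (Finset.prod_nonneg fun _ _ => hp _ _) (Finset.prod_nonneg fun _ _ => hq _ _))
    (Finset.mem_univ η))
  rw [mul_add, neg_add, Real.exp_add]
  exact mul_le_mul (exp_neg_mul_card_le_prod _ fun j => hpC _ _ (h1 j (Finset.mem_univ _)))
    (exp_neg_mul_card_le_prod _ fun t => hqC _ _ (h2 t (Finset.mem_univ _)))
    (Real.exp_pos _).le (Finset.prod_nonneg fun _ _ => hp _ _)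

lemma Protocol.abs_log_blockOutput_le [Fintype 𝒵] (hp : ∀ θ x, 0 ≤ p θ x) (hq : ∀ θ x, 0 ≤ q θ x)
    (hp1 : ∀ θ, ∑ x, p θ x = 1) (hq1 : ∀ θ, ∑ x, q θ x = 1) {C : ℝ} (hC : 0 ≤ C)
    (hpC : ∀ θ x, p θ x ≠ 0 → Real.exp (-C) ≤ p θ x)
    (hqC : ∀ θ x, q θ x ≠ 0 → Real.exp (-C) ≤ q θ x)
    (i : ι) (ζ : {t // bZ t = i} → 𝒵) :
    |Real.log (π.blockOutput bY bZ y₀ p q true i ζ / π.blockOutput bY bZ y₀ p q false i ζ)|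
      ≤ C * (Fintype.card {j // bY j = i} + Fintype.card {t // bZ t = i}) := by
  have hc : 0 ≤ C * ((Fintype.card {j // bY j = i} : ℝ) + Fintype.card {t // bZ t = i}) := by
    positivity
  -- Off the common support the quotient is 0 and `Real.log 0 = 0`; on it both logarithms lie in
  -- [-c, 0], c being the claimed bound.
  by_cases h : π.blockOutput bY bZ y₀ p q true i ζ = 0
  · simpa [h] using hc
  by_cases h' : π.blockOutput bY bZ y₀ p q false i ζ = 0
  · simpa [h'] using hc
  have hlog : ∀ θ, π.blockOutput bY bZ y₀ p q θ i ζ ≠ 0 →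
      -(C * ((Fintype.card {j // bY j = i} : ℝ) + Fintype.card {t // bZ t = i}))
          ≤ Real.log (π.blockOutput bY bZ y₀ p q θ i ζ) ∧
        Real.log (π.blockOutput bY bZ y₀ p q θ i ζ) ≤ 0 := fun θ hθ => by
    have h0 := π.blockOutput_nonneg bY bZ y₀ hp hq θ i ζ
    exact ⟨(Real.le_log_iff_exp_le (lt_of_le_of_ne h0 (Ne.symm hθ))).2
      (π.exp_le_blockOutput bY bZ y₀ hp hq hpC hqC θ i ζ hθ),
      Real.log_nonpos h0 (π.blockOutput_le_one bY bZ y₀ hp hq hp1 hq1 θ i ζ)⟩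
  rw [Real.log_div h h', abs_le]
  have h1 := hlog true h
  have h2 := hlog false h'
  constructor <;> linarith

/-- The overlap of the student's observations under the two hypotheses, for a teacher whose
transmissions in the block `i` of `bZ` depend on the block `i` of `bY` alone. -/
theorem Protocol.le_sum_min_output [Fintype ι] [Fintype 𝒵] (hp : ∀ θ x, 0 ≤ p θ x) (hq : ∀ θ x, 0 ≤ q θ x)
    (hp1 : ∀ θ, ∑ x, p θ x = 1) (hq1 : ∀ θ, ∑ x, q θ x = 1) {C : ℝ} (hC : 0 ≤ C)
    (hpC : ∀ θ x, p θ x ≠ 0 → Real.exp (-C) ≤ p θ x)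
    (hqC : ∀ θ x, q θ x ≠ 0 → Real.exp (-C) ≤ q θ x)
    (hdep : ∀ (t : Fin n) (y y' : Fin n → 𝒴), (∀ j, bY j = bZ t → y j = y' j) →
      π.teacher y t = π.teacher y' t)
    {N R d : ℝ} (hN : ∀ i, (Fintype.card {j // bY j = i} : ℝ) + Fintype.card {t // bZ t = i} ≤ N)
    (hR : 0 < R) (hρ : ∀ s ∈ Icc (0 : ℝ) 1,
      R ≤ ∑ z, geomWeight s (π.output p q false z) (π.output p q true z))
    (hd : 0 < d) (hdN : 4 * C ^ 2 * N * n ≤ d ^ 2) :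
    R / 2 * Real.exp (-d) ≤ ∑ z, min (π.output p q false z) (π.output p q true z) := by
  obtain ⟨y₀, -⟩ : ∃ y₀, p false y₀ ≠ 0 := by
    by_contra! h
    simpa [h] using hp1 false
  have hfac := π.output_eq_prod bY bZ y₀ hdep p q
  simp only [hfac] at hρ ⊢
  rw [Fintype.sum_equiv (fiberPiEquiv bZ 𝒵) _
    (fun w => min (∏ i, π.blockOutput bY bZ y₀ p q false i (w i))
      (∏ i, π.blockOutput bY bZ y₀ p q true i (w i))) fun z => rfl]
  refine le_sum_min_prod _ _ _ (fun i x => π.blockOutput_nonneg bY bZ y₀ hp hq _ i x)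
    (fun i x => π.blockOutput_nonneg bY bZ y₀ hp hq _ i x)
    (fun i x => π.abs_log_blockOutput_le bY bZ y₀ hp hq hp1 hq1 hC hpC hqC i x) hR ?_ hd
    (le_trans ?_ hdN)
  · intro s hs
    refine (hρ s hs).trans_eq (Fintype.sum_equiv (fiberPiEquiv bZ 𝒵) _ _ fun z => rfl)
  · have hcard : ∀ b : Fin n → ι, ∑ i, (Fintype.card {j // b j = i} : ℝ) = n := by
      intro b
      rw [← Nat.cast_sum, ← Fintype.card_sigma, Fintype.card_congr (Equiv.sigmaFiberEquiv b),
        Fintype.card_fin]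
    -- One factor of each square is at most `N`; the other sums to 2n, since both families of fibres
    -- partition the n times.
    calc 2 * ∑ i, (C * ((Fintype.card {j // bY j = i} : ℝ) + Fintype.card {t // bZ t = i})) ^ 2
        ≤ 2 * ∑ i, C ^ 2 * N
            * ((Fintype.card {j // bY j = i} : ℝ) + Fintype.card {t // bZ t = i}) := by
          gcongr with i
          rw [mul_pow, mul_assoc, sq (_ + _)]
          gcongr
          exact hN i
      _ = 4 * C ^ 2 * N * n := by
          rw [← Finset.mul_sum, Finset.sum_add_distrib, hcard, hcard]
          ring

end Blocks

end Output

/-! ### From `PMF`s to real weights -/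

lemma rho_eq_ofReal {Ω : Type*} [Fintype Ω] (A B : PMF Ω) (s : ℝ) :
    rho A B s = ENNReal.ofReal (∑ x, geomWeight s (A x).toReal (B x).toReal) := by
  rw [ENNReal.ofReal_sum_of_nonneg fun x _ =>
    geomWeight_nonneg s ENNReal.toReal_nonneg ENNReal.toReal_nonneg]
  refine Finset.sum_congr rfl fun x _ => ?_
  have hiff : (A x = 0 ∨ B x = 0) ↔ ((A x).toReal = 0 ∨ (B x).toReal = 0) := by
    simp [ENNReal.toReal_eq_zero_iff, PMF.apply_ne_top]
  by_cases h : A x = 0 ∨ B x = 0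
  · rw [if_pos h, geomWeight, if_pos (hiff.1 h), ENNReal.ofReal_zero]
  · rw [if_neg h, geomWeight, if_neg (hiff.not.1 h)]
    rw [not_or] at h
    have hA := ENNReal.toReal_pos h.1 (A.apply_ne_top x)
    have hB := ENNReal.toReal_pos h.2 (B.apply_ne_top x)
    rw [ENNReal.ofReal_mul (Real.rpow_nonneg hA.le _), ← ENNReal.ofReal_rpow_of_pos hA,
      ← ENNReal.ofReal_rpow_of_pos hB, ENNReal.ofReal_toReal (A.apply_ne_top x),
      ENNReal.ofReal_toReal (B.apply_ne_top x)]

lemma sum_toReal_eq_one {Ω : Type*} [Fintype Ω] (A : PMF Ω) : ∑ x, (A x).toReal = 1 := by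
  rw [← ENNReal.toReal_sum fun x _ => A.apply_ne_top x, ← tsum_fintype (L := .unconditional Ω),
    A.tsum_coe, ENNReal.toReal_one]

lemma SkewCondition.sum_geomWeight_le {Ω : Type*} [Fintype Ω] {P : BinaryChannel Ω}
    (h : SkewCondition P) {s : ℝ} (hs : s ∈ Icc (0 : ℝ) (1 / 2)) :
    ∑ x, geomWeight s (P false x).toReal (P true x).toReal
      ≤ ∑ x, geomWeight (1 - s) (P false x).toReal (P true x).toReal := by
  have := h s hs
  rw [mu, mu, ENNReal.log_le_log_iff, rho_eq_ofReal, rho_eq_ofReal] at this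
  exact (ENNReal.ofReal_le_ofReal_iff (Finset.sum_nonneg fun x _ =>
    geomWeight_nonneg _ ENNReal.toReal_nonneg ENNReal.toReal_nonneg)).1 this

lemma le_sum_geomWeight_of_le_mu {Ω : Type*} [Fintype Ω] {P : BinaryChannel Ω} {s m : ℝ}
    (h : (m : EReal) ≤ mu P s) :
    Real.exp m ≤ ∑ x, geomWeight s (P false x).toReal (P true x).toReal := by
  rw [mu, ← EReal.log_exp (m : EReal), ENNReal.log_le_log_iff, rho_eq_ofReal, EReal.exp_coe] at h
  exact (ENNReal.ofReal_le_ofReal_iff (Finset.sum_nonneg fun x _ =>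
    geomWeight_nonneg _ ENNReal.toReal_nonneg ENNReal.toReal_nonneg)).1 h

lemma exists_exp_neg_le {Ω : Type*} [Fintype Ω] (f : Ω → ℝ) (hf : ∀ x, 0 ≤ f x) :
    ∃ C : ℝ, 0 ≤ C ∧ ∀ x, f x ≠ 0 → Real.exp (-C) ≤ f x := by
  refine ⟨∑ x, |Real.log (f x)|, Finset.sum_nonneg fun _ _ => abs_nonneg _, fun x hx => ?_⟩
  rw [← Real.le_log_iff_exp_le (lt_of_le_of_ne (hf x) (Ne.symm hx))]
  have := Finset.single_le_sum (f := fun x => |Real.log (f x)|) (fun _ _ => abs_nonneg _)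
    (Finset.mem_univ x)
  linarith [neg_abs_le (Real.log (f x))]

/-! ### Error probability for a fixed number of transmissions -/

/-- The bit transmitted at time `t` depends only on the preceding block of the teacher's
observations, or on the first block if `t` belongs to it. -/
lemma Protocol.IsBlockStructured.teacher_congr {𝒴 𝒵 : Type*} {n k : ℕ} {π : Protocol 𝒴 𝒵 n}
    (h : π.IsBlockStructured k) (hk : 0 < k) (t : Fin n) (y y' : Fin n → 𝒴)
    (hy : ∀ j : Fin n, (j : ℕ) / k = (t : ℕ) / k - 1 → y j = y' j) :
    π.teacher y t = π.teacher y' t := by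
  rcases Nat.eq_zero_or_pos ((t : ℕ) / k) with h0 | h0
  · refine π.causal t y y' fun j hj => hy j ?_
    have : (j : ℕ) / k ≤ (t : ℕ) / k := Nat.div_le_div_right hj
    rw [h0] at this ⊢
    exact Nat.le_zero.1 this
  · obtain ⟨i, hi⟩ : ∃ i, (t : ℕ) / k = i + 1 := ⟨(t : ℕ) / k - 1, by omega⟩
    refine h i t ?_ ?_ y y' fun j h1 h2 => hy j ?_
    · rw [mul_comm]
      exact (Nat.le_div_iff_mul_le hk).1 hi.ge
    · rw [mul_comm]
      exact (Nat.div_lt_iff_lt_mul hk).1 (by omega)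
    · rw [hi, Nat.add_sub_cancel]
      rw [mul_comm] at h1 h2
      have := (Nat.le_div_iff_mul_le hk).2 h1
      have := (Nat.div_lt_iff_lt_mul hk).2 h2
      omega

variable {𝒴 𝒵 : Type*} [Fintype 𝒴] [Fintype 𝒵]

/-- The error probability is at least half the overlap of the distributions of the student's
observations under the two hypotheses. -/
lemma Protocol.ofReal_sum_min_le_errorProb {n : ℕ} (π : Protocol 𝒴 𝒵 n) (P : BinaryChannel 𝒴)
    (Q : BinaryChannel 𝒵) :
    ENNReal.ofReal (1 / 2 * ∑ z,
      min (π.output (fun θ x => (P θ x).toReal) (fun θ x => (Q θ x).toReal) false z)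
        (π.output (fun θ x => (P θ x).toReal) (fun θ x => (Q θ x).toReal) true z))
      ≤ π.errorProb P Q := by
  have hout : ∀ θ z, ENNReal.ofReal
      (1 / 2 * π.output (fun θ x => (P θ x).toReal) (fun θ x => (Q θ x).toReal) θ z)
        = ∑ y, π.jointProb P Q θ y z := by
    intro θ z
    rw [Protocol.output, Finset.mul_sum, ENNReal.ofReal_sum_of_nonneg fun y _ => by positivity]
    refine Finset.sum_congr rfl fun y _ => ?_
    simp only [Protocol.jointProb, ← ENNReal.toReal_prod]
    rw [ENNReal.ofReal_mul (by norm_num), ENNReal.ofReal_mul ENNReal.toReal_nonneg,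
      ENNReal.ofReal_toReal (ENNReal.prod_ne_top fun _ _ => PMF.apply_ne_top _ _),
      ENNReal.ofReal_toReal (ENNReal.prod_ne_top fun _ _ => PMF.apply_ne_top _ _), mul_assoc]
    congr 1
    rw [one_div, ENNReal.ofReal_inv_of_pos two_pos]
    simp
  have hnn : ∀ θ z, 0 ≤ π.output (fun θ x => (P θ x).toReal) (fun θ x => (Q θ x).toReal) θ z :=
    fun θ z => Finset.sum_nonneg fun y _ => by positivity
  have herr : π.errorProb P Q
      = ∑ z, ∑ θ, if π.student z = θ then 0 else ∑ y, π.jointProb P Q θ y z := by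
    unfold Protocol.errorProb
    symm
    rw [Finset.sum_comm]
    refine Finset.sum_congr rfl fun θ _ => ?_
    rw [Finset.sum_comm (s := (Finset.univ : Finset (Fin n → 𝒴)))]
    refine Finset.sum_congr rfl fun z _ => ?_
    split_ifs <;> simp
  rw [herr, Finset.mul_sum, ENNReal.ofReal_sum_of_nonneg fun z _ =>
    mul_nonneg (by norm_num) (le_min (hnn _ _) (hnn _ _))]
  refine Finset.sum_le_sum fun z _ => ?_
  -- For each `z` the rejected hypothesis contributes its full mass, which is at least the minimum.
  rw [Fintype.sum_bool]
  cases h : π.student z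
  · simp only [Bool.false_eq_true, if_false, if_true, add_zero, ← hout]
    exact ENNReal.ofReal_le_ofReal (by gcongr; exact min_le_right _ _)
  · simp only [Bool.true_eq_false, if_false, if_true, zero_add, ← hout]
    exact ENNReal.ofReal_le_ofReal (by gcongr; exact min_le_left _ _)

lemma card_filter_div_eq_le (n k i : ℕ) (hk : 0 < k) :
    (Finset.univ.filter fun j : Fin n => (j : ℕ) / k = i).card ≤ k := by
  calc _ ≤ (Finset.range k).card := by
        refine Finset.card_le_card_of_injOn (fun j : Fin n => (j : ℕ) % k)
          (fun j _ => by simpa using Nat.mod_lt _ hk) ?_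
        intro a ha b hb hab
        have ha' : (a : ℕ) / k = i := by simpa using ha
        have hb' : (b : ℕ) / k = i := by simpa using hb
        have hab' : (a : ℕ) % k = (b : ℕ) % k := hab
        ext
        rw [← Nat.div_add_mod (a : ℕ) k, ← Nat.div_add_mod (b : ℕ) k, ha', hb', hab']
    _ = k := Finset.card_range k

/-- The error probability of a block structured protocol, when `exp m` is a lower bound on the
larger of the two Chernoff coefficients and `exp (-C)` one on the positive transition
probabilities. -/
lemma Protocol.IsBlockStructured.ofReal_le_errorProb {n k : ℕ} {π : Protocol 𝒴 𝒵 n}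
    (h : π.IsBlockStructured k) (hk : 0 < k) {P : BinaryChannel 𝒴} {Q : BinaryChannel 𝒵}
    (hP : SkewCondition P) (hQ : SkewCondition Q) {C m d : ℝ} (hC : 0 ≤ C)
    (hPC : ∀ θ x, (P θ x).toReal ≠ 0 → Real.exp (-C) ≤ (P θ x).toReal)
    (hQC : ∀ θ x, (Q θ x).toReal ≠ 0 → Real.exp (-C) ≤ (Q θ x).toReal)
    (hm : ∀ s ∈ Icc (0 : ℝ) 1, (m : EReal) ≤ max (mu P s) (mu Q s)) (hd : 0 < d)
    (hdn : 12 * C ^ 2 * k * n ≤ d ^ 2) :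
    ENNReal.ofReal (Real.exp (n * m - d - Real.log 4)) ≤ π.errorProb P Q := by
  refine le_trans (ENNReal.ofReal_le_ofReal ?_) (π.ofReal_sum_min_le_errorProb P Q)
  set p : Bool → 𝒴 → ℝ := fun θ x => (P θ x).toReal
  set q : Bool → 𝒵 → ℝ := fun θ x => (Q θ x).toReal
  have hp : ∀ θ x, 0 ≤ p θ x := fun _ _ => ENNReal.toReal_nonneg
  have hq : ∀ θ x, 0 ≤ q θ x := fun _ _ => ENNReal.toReal_nonneg
  have hp1 : ∀ θ, ∑ x, p θ x = 1 := fun θ => sum_toReal_eq_one (P θ)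
  have hq1 : ∀ θ, ∑ x, q θ x = 1 := fun θ => sum_toReal_eq_one (Q θ)
  have hρ := fun s hs => π.pow_le_output (s := s) hp hq hp1 hq1
    (fun s hs => hP.sum_geomWeight_le hs) (fun s hs => hQ.sum_geomWeight_le hs)
    (Real.exp_pos m).le
    (fun s hs => le_max_iff.2 ((le_max_iff.1 (hm s hs)).imp le_sum_geomWeight_of_le_mu
      le_sum_geomWeight_of_le_mu)) hs
  let bY : Fin n → Fin n := fun j => ⟨(j : ℕ) / k, (Nat.div_le_self _ _).trans_lt j.2⟩
  -- Truncated subtraction merges the student's first two blocks, both governed by the teacher's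
  -- first block. Hence up to 2k received symbols per group, and 3k with the teacher's.
  let bZ : Fin n → Fin n := fun t =>
    ⟨(t : ℕ) / k - 1, ((Nat.sub_le _ _).trans (Nat.div_le_self _ _)).trans_lt t.2⟩
  have hY : ∀ i, Fintype.card {j // bY j = i} ≤ k := fun i => by
    rw [Fintype.card_subtype]
    refine le_trans (Finset.card_le_card fun j hj => ?_) (card_filter_div_eq_le n k i hk)
    simpa [bY, Fin.ext_iff] using hj
  have hZ : ∀ i, Fintype.card {t // bZ t = i} ≤ 2 * k := fun i => by
    rw [Fintype.card_subtype, two_mul]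
    refine le_trans (Finset.card_le_card (t := (Finset.univ.filter fun j : Fin n =>
      (j : ℕ) / k = i) ∪ Finset.univ.filter fun j : Fin n => (j : ℕ) / k = i + 1) fun t ht => ?_)
      ((Finset.card_union_le _ _).trans
        (add_le_add (card_filter_div_eq_le n k i hk) (card_filter_div_eq_le n k (i + 1) hk)))
    have ht' : (t : ℕ) / k - 1 = i := by simpa [bZ, Fin.ext_iff] using ht
    simp only [Finset.mem_union, Finset.mem_filter, Finset.mem_univ, true_and]
    generalize (t : ℕ) / k = a at ht' ⊢
    omega
  have hmain := π.le_sum_min_output bY bZ hp hq hp1 hq1 hC hPC hQC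
    (fun t y y' hy => h.teacher_congr hk t y y' fun j hj => hy j (Fin.ext hj))
    (N := 3 * k) (fun i => by
      have h1 : (Fintype.card {j // bY j = i} : ℝ) ≤ k := by exact_mod_cast hY i
      have h2 : (Fintype.card {t // bZ t = i} : ℝ) ≤ 2 * k := by exact_mod_cast hZ i
      linarith)
    (pow_pos (Real.exp_pos m) n) hρ hd (by linarith)
  -- The 4 combines the prior 1/2 with the 1/2 from Chebyshev's inequality.
  calc Real.exp (n * m - d - Real.log 4)
      = 1 / 2 * (Real.exp m ^ n / 2 * Real.exp (-d)) := by
        rw [Real.exp_sub, Real.exp_sub, Real.exp_nat_mul, Real.exp_neg, Real.exp_log (by norm_num)]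
        field_simp
        norm_num
    _ ≤ _ := mul_le_mul_of_nonneg_left hmain (by norm_num)

/-! ### Asymptotics and conclusion -/

/-- The correction terms in the error exponent are negligible for short blocks. -/
lemma tendsto_exponent (m c : ℝ) (k : ℕ → ℕ)
    (hk : (fun n : ℕ => (k n : ℝ)) =o[atTop] (fun n : ℕ => (n : ℝ))) :
    Tendsto (fun n : ℕ => -((n * m - (√(c * k n * n) + 1) - Real.log 4) / n)) atTop (𝓝 (-m)) := by
  have h1 : Tendsto (fun n : ℕ => √(c * (k n / n))) atTop (𝓝 0) := by
    have := (hk.tendsto_div_nhds_zero.const_mul c).sqrt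
    rwa [mul_zero, Real.sqrt_zero] at this
  have h2 : Tendsto (fun n : ℕ => (1 + Real.log 4) / (n : ℝ)) atTop (𝓝 0) :=
    tendsto_const_div_atTop_nhds_zero_nat _
  have h3 := (tendsto_const_nhds (x := -m)).add (h1.add h2)
  rw [add_zero, add_zero] at h3
  refine h3.congr' ?_
  filter_upwards [eventually_gt_atTop 0] with n hn
  have hn' : (0 : ℝ) < n := by exact_mod_cast hn
  have hsqrt : √(c * (k n / n)) = √(c * k n * n) / n := by
    rw [show c * ((k n : ℝ) / n) = c * k n * n / (n : ℝ) ^ 2 by field_simp,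
      Real.sqrt_div' _ (by positivity), Real.sqrt_sq hn'.le]
  rw [hsqrt]
  field_simp
  ring

lemma mu_ne_top {Ω : Type*} [Fintype Ω] (P : BinaryChannel Ω) (s : ℝ) : mu P s ≠ ⊤ := by
  rw [mu, Ne, ENNReal.log_eq_top_iff, rho_eq_ofReal]
  exact ENNReal.ofReal_ne_top

end TeachLearn

theorem theorem4 {𝒴 𝒵 : Type*} [Fintype 𝒴] [Fintype 𝒵]
    (P : TeachLearn.BinaryChannel 𝒴) (Q : TeachLearn.BinaryChannel 𝒵)
    (hP : TeachLearn.SkewCondition P) (hQ : TeachLearn.SkewCondition Q)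
    (k : ℕ → ℕ) (hk_pos : ∀ n, 0 < k n)
    (hk : (fun n : ℕ => (k n : ℝ)) =o[atTop] (fun n : ℕ => (n : ℝ)))
    (π : ∀ n : ℕ, TeachLearn.Protocol 𝒴 𝒵 n)
    (hπ : ∀ n, (π n).IsBlockStructured (k n)) :
    TeachLearn.learningRate P Q π
      ≤ -(⨅ s ∈ Icc (0 : ℝ) 1, max (TeachLearn.mu P s) (TeachLearn.mu Q s)) := by
  have hM : ∀ s ∈ Icc (0 : ℝ) 1, (⨅ s ∈ Icc (0 : ℝ) 1, max (TeachLearn.mu P s) (TeachLearn.mu Q s))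
      ≤ max (TeachLearn.mu P s) (TeachLearn.mu Q s) := fun s hs => iInf₂_le s hs
  generalize (⨅ s ∈ Icc (0 : ℝ) 1, max (TeachLearn.mu P s) (TeachLearn.mu Q s)) = M at hM ⊢
  induction M using EReal.rec with
  | bot => simp
  | top =>
    rcases le_max_iff.1 (hM 0 (by simp)) with h | h
    · exact absurd (top_le_iff.1 h) (TeachLearn.mu_ne_top P 0)
    · exact absurd (top_le_iff.1 h) (TeachLearn.mu_ne_top Q 0)
  | coe m =>
    obtain ⟨C₁, hC₁, hPC⟩ := TeachLearn.exists_exp_neg_le (fun w : Bool × 𝒴 => (P w.1 w.2).toReal)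
      fun _ => ENNReal.toReal_nonneg
    obtain ⟨C₂, hC₂, hQC⟩ := TeachLearn.exists_exp_neg_le (fun w : Bool × 𝒵 => (Q w.1 w.2).toReal)
      fun _ => ENNReal.toReal_nonneg
    set C := C₁ + C₂
    have herr := fun n => (hπ n).ofReal_le_errorProb (hk_pos n) hP hQ (C := C) (m := m)
      -- The added 1 keeps `d` positive when the root vanishes.
      (d := √(12 * C ^ 2 * k n * n) + 1) (add_nonneg hC₁ hC₂)
      (fun θ x h => (Real.exp_le_exp.2 (by simp only [C]; linarith)).trans (hPC (θ, x) h))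
      (fun θ x h => (Real.exp_le_exp.2 (by simp only [C]; linarith)).trans (hQC (θ, x) h))
      hM (by positivity)
      (by nlinarith [Real.sq_sqrt (show 0 ≤ 12 * C ^ 2 * k n * n by positivity),
        Real.sqrt_nonneg (12 * C ^ 2 * k n * n)])
    have hlim := (continuous_coe_real_ereal.tendsto _).comp
      (TeachLearn.tendsto_exponent m (12 * C ^ 2) k hk)
    rw [← EReal.coe_neg, ← hlim.limsup_eq]
    refine limsup_le_limsup (Eventually.of_forall fun n => ?_)
    have hlog := ENNReal.log_monotone (herr n)
    rw [← EReal.exp_coe, EReal.log_exp] at hlog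
    simp only [Function.comp_apply]
    rw [EReal.coe_neg, EReal.coe_div, EReal.neg_le_neg_iff]
    exact EReal.monotone_div_right_of_nonneg n.cast_nonneg' hlog
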